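/- Let $d$ be a nonnegative integer, let $S^d=\{x\in\mathbb{R}^{d+1}:\|x\|_2=1\}$, and let $C_1,\dots,C_d$ be open subsets of $S^d$ with $C_1\cup\dots\cup C_d=S^d$, each of which is antipodally symmetric, that is, $-C_i=C_i$. Then for some $i$ there is a point $x\in C_i$ such that $x$ and $-x$ lie in the same connected component of $C_i$. -/

import Mathlib

open scoped Pointwise

/-! Suppose no component of any `C i` contains an antipodal pair. Negation then permutes the
components of `C i` without fixing any, and choosing one from each pair gives an odd `χ i` with
values in `ZMod 2`, constant on each component of `C i`. By Lebesgue's lemma every sufficiently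
small set lies in one component of one `C i`, so some `χ i` is constant on it.

`exists_small_list_of_odd`, a lemma of Tucker type, contradicts this. Take chains with `∂h (k+1) = h
k + ν (h k)`, where `ν` is the antipodal map. By Stokes and oddness the cup product of the
coboundaries of `k` odd functions takes the value 1 on `h k` (`extend_signChanges_eq_one`), so on
some simplex of `h d` every `χ i` changes value. Iterated barycentric subdivision of octahedral
hemispheres, projected radially, makes the simplices small. Only chain identities are used, so
degenerate simplices do no harm. -/

/-! ### Ordered simplicial chains modulo two -/

/-- Chains modulo two of ordered simplices, a simplex being the list of its vertices. -/
abbrev OrderedChain (V : Type*) := List V →₀ ZMod 2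

namespace OrderedChain

variable {V W M : Type*} [AddCommGroup M] [Module (ZMod 2) M]

/-- The chain consisting of a single simplex. -/
noncomputable def of (l : List V) : OrderedChain V := Finsupp.single l 1

/-- The linear extension of a function on simplices. -/
noncomputable def extend (f : List V → M) : OrderedChain V →ₗ[ZMod 2] M :=
  Finsupp.linearCombination (ZMod 2) f

@[simp] theorem extend_of (f : List V → M) (l : List V) : extend f (of l) = f l := by
  simp [extend, of]

theorem hom_ext {f g : OrderedChain V →ₗ[ZMod 2] M} (h : ∀ l, f (of l) = g (of l)) : f = g :=
  Finsupp.lhom_ext' fun l => LinearMap.ext_ring (h l)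

theorem add_self (c : OrderedChain V) : c + c = 0 := by
  ext l
  exact CharTwo.add_self_eq_zero _

/-- The chains all of whose simplices satisfy `Q`. -/
noncomputable def supportedOn (Q : List V → Prop) : Submodule (ZMod 2) (OrderedChain V) :=
  Submodule.span (ZMod 2) (of '' {l | Q l})

theorem of_mem {Q : List V → Prop} {l : List V} (h : Q l) : of l ∈ supportedOn Q :=
  Submodule.subset_span ⟨l, h, rfl⟩

theorem map_mem {Q : List V → Prop} {p : Submodule (ZMod 2) M}
    {f : OrderedChain V →ₗ[ZMod 2] M} (h : ∀ l, Q l → f (of l) ∈ p)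
    {c : OrderedChain V} (hc : c ∈ supportedOn Q) : f c ∈ p := by
  have : supportedOn Q ≤ p.comap f := by
    refine Submodule.span_le.2 ?_
    rintro _ ⟨l, hl, rfl⟩
    exact h l hl
  exact this hc

theorem supportedOn_mono {Q Q' : List V → Prop} (h : ∀ l, Q l → Q' l) :
    supportedOn Q ≤ supportedOn Q' :=
  Submodule.span_mono (Set.image_mono h)

theorem eq_of_mem {Q : List V → Prop} {f g : OrderedChain V →ₗ[ZMod 2] M}
    (h : ∀ l, Q l → f (of l) = g (of l)) {c : OrderedChain V} (hc : c ∈ supportedOn Q) :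
    f c = g c := by
  refine LinearMap.eqOn_span' (s := of '' {l | Q l}) ?_ hc
  rintro _ ⟨l, hl, rfl⟩
  exact h l hl

/-- The cone with apex `v`. -/
noncomputable def cone (v : V) : OrderedChain V →ₗ[ZMod 2] OrderedChain V :=
  extend fun l => of (v :: l)

/-- The chain map induced by a map of vertices. -/
noncomputable def map (f : V → W) : OrderedChain V →ₗ[ZMod 2] OrderedChain W :=
  extend fun l => of (l.map f)

/-- The (augmented) boundary of a simplex. -/
noncomputable def simplexBoundary : List V → OrderedChain V
  | [] => 0
  | v :: l => of l + cone v (simplexBoundary l)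

/-- The augmented boundary operator. -/
noncomputable def boundary : OrderedChain V →ₗ[ZMod 2] OrderedChain V := extend simplexBoundary

@[simp] theorem cone_of (v : V) (l : List V) : cone v (of l) = of (v :: l) := by simp [cone]

@[simp] theorem map_of (f : V → W) (l : List V) : map f (of l) = of (l.map f) := by simp [map]

@[simp] theorem boundary_of_nil : boundary (of ([] : List V)) = 0 := by
  simp [boundary, simplexBoundary]

theorem boundary_of_cons (v : V) (l : List V) :
    boundary (of (v :: l)) = of l + cone v (boundary (of l)) := by
  simp [boundary, simplexBoundary]

theorem boundary_cone (v : V) (c : OrderedChain V) :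
    boundary (cone v c) = c + cone v (boundary c) := by
  have : boundary ∘ₗ cone v = LinearMap.id + cone v ∘ₗ boundary :=
    hom_ext fun l => by simp [boundary_of_cons]
  exact LinearMap.congr_fun this c

theorem map_cone (f : V → W) (v : V) (c : OrderedChain V) :
    map f (cone v c) = cone (f v) (map f c) := by
  have : map f ∘ₗ cone v = cone (f v) ∘ₗ map f := hom_ext fun l => by simp
  exact LinearMap.congr_fun this c

theorem boundary_boundary (c : OrderedChain V) : boundary (boundary c) = 0 := by
  have : (boundary ∘ₗ boundary : OrderedChain V →ₗ[ZMod 2] OrderedChain V) = 0 := by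
    refine hom_ext fun l => ?_
    induction l with
    | nil => simp
    | cons v l ih =>
      have ih' : boundary (boundary (of l)) = 0 := ih
      simp [boundary_of_cons, boundary_cone, ih', add_self, add_comm (boundary _)]
  exact LinearMap.congr_fun this c

theorem boundary_map (f : V → W) (c : OrderedChain V) :
    boundary (map f c) = map f (boundary c) := by
  have : boundary ∘ₗ map f = map f ∘ₗ boundary := by
    refine hom_ext fun l => ?_
    induction l with
    | nil => simp
    | cons v l ih =>
      have ih' : boundary (of (l.map f)) = map f (boundary (of l)) := by simpa using ih
      simp [boundary_of_cons, map_cone, ih']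
  exact LinearMap.congr_fun this c

theorem map_neg_map_neg [InvolutiveNeg V] (c : OrderedChain V) :
    map Neg.neg (map Neg.neg c) = c := by
  have : map Neg.neg ∘ₗ map Neg.neg = (LinearMap.id : OrderedChain V →ₗ[ZMod 2] _) :=
    hom_ext fun l => by simp
  exact LinearMap.congr_fun this c

theorem boundary_of_mem (l : List V) :
    boundary (of l) ∈ supportedOn fun l' => l'.length + 1 = l.length ∧ l' ⊆ l := by
  induction l with
  | nil => simp
  | cons v l ih =>
    rw [boundary_of_cons]
    refine add_mem (of_mem (by simp)) (map_mem (fun l' hl' => ?_) ih)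
    rw [cone_of]
    exact of_mem ⟨by simp [hl'.1], List.cons_subset_cons _ hl'.2⟩

/-! ### The cochain of sign changes -/

/-- The product of the coboundaries of the functions in the list, evaluated at a simplex. -/
def signChanges : List (V → ZMod 2) → List V → ZMod 2
  | [], [] => 0
  | [], [_] => 1
  | [], _ :: _ :: _ => 0
  | _ :: _, [] => 0
  | _ :: _, [_] => 0
  | s :: ss, v :: w :: l => (s v + s w) * signChanges ss (w :: l)

/-- The product of a function with the cochain `signChanges`. -/
def headMulSignChanges (s : V → ZMod 2) (ss : List (V → ZMod 2)) : List V → ZMod 2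
  | [] => 0
  | v :: l => s v * signChanges ss (v :: l)

theorem signChanges_nil_right (ss : List (V → ZMod 2)) : signChanges ss [] = 0 := by
  cases ss <;> rfl

/-- Leibniz rule: `δ(s ∪ α) = δs ∪ α` for a cocycle `α`. On the faces containing the first vertex
`v`, the factor `s v` comes out, and the cocycle condition trades their total for the value of `α`
on the opposite face. -/
theorem extend_headMulSignChanges_boundary_of (s : V → ZMod 2) (ss : List (V → ZMod 2))
    (h : ∀ l, extend (signChanges ss) (boundary (of l)) = 0) (l : List V) :
    extend (headMulSignChanges s ss) (boundary (of l)) = signChanges (s :: ss) l := by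
  have hcone (v : V) (c : OrderedChain V) : extend (headMulSignChanges s ss) (cone v c) =
      s v * extend (signChanges ss) (cone v c) := by
    have : extend (headMulSignChanges s ss) ∘ₗ cone v =
        s v • (extend (signChanges ss) ∘ₗ cone v) :=
      hom_ext fun l => by simp [headMulSignChanges]
    exact LinearMap.congr_fun this c
  cases l with
  | nil => simp [signChanges]
  | cons v l =>
    have h' := h (v :: l)
    rw [boundary_of_cons, map_add, extend_of, CharTwo.add_eq_zero] at h'
    rw [boundary_of_cons, map_add, extend_of, hcone, ← h']
    cases l with
    | nil => simp [headMulSignChanges, signChanges, signChanges_nil_right]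
    | cons w l =>
      simp only [headMulSignChanges, signChanges]
      ring

/-- A nonempty product is itself a coboundary by the Leibniz rule. The empty product counts
vertices: an edge has two, and the empty simplex, which bounds a vertex, must get 0. -/
theorem extend_signChanges_boundary_of (ss : List (V → ZMod 2)) (l : List V) :
    extend (signChanges ss) (boundary (of l)) = 0 := by
  induction ss generalizing l with
  | nil =>
    have hcone (v w : V) (c : OrderedChain V) :
        extend (signChanges []) (cone v (cone w c)) = 0 := by
      have : extend (signChanges []) ∘ₗ cone v ∘ₗ cone w = 0 :=
        hom_ext fun l => by simp [signChanges]
      exact LinearMap.congr_fun this c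
    match l with
    | [] => simp
    | [v] => simp [boundary_of_cons, signChanges]
    | [v, w] =>
      simp [boundary_of_cons, signChanges]
      exact CharTwo.add_self_eq_zero _
    | v :: w :: x :: l =>
      rw [boundary_of_cons, boundary_of_cons w, map_add, map_add, map_add, hcone]
      simp [signChanges]
  | cons s ss ih =>
    have : extend (signChanges (s :: ss)) = extend (headMulSignChanges s ss) ∘ₗ boundary :=
      hom_ext fun l => by simp [extend_headMulSignChanges_boundary_of s ss ih]
    simp [this, boundary_boundary]

theorem extend_signChanges_cons (s : V → ZMod 2) (ss : List (V → ZMod 2)) (c : OrderedChain V) :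
    extend (signChanges (s :: ss)) c = extend (headMulSignChanges s ss) (boundary c) := by
  have : extend (signChanges (s :: ss)) = extend (headMulSignChanges s ss) ∘ₗ boundary :=
    hom_ext fun l => by
      simp [extend_headMulSignChanges_boundary_of s ss (extend_signChanges_boundary_of ss)]
  exact LinearMap.congr_fun this c

theorem signChanges_eq_zero {s : V → ZMod 2} {ss : List (V → ZMod 2)} (hs : s ∈ ss) {l : List V}
    (h : ∀ x ∈ l, ∀ y ∈ l, s x = s y) : signChanges ss l = 0 := by
  induction ss generalizing l with
  | nil => simp at hs
  | cons t ss ih =>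
    match l with
    | [] => rfl
    | [v] => rfl
    | v :: w :: l =>
      rw [signChanges]
      rcases List.mem_cons.1 hs with rfl | hs
      · rw [h v (by simp) w (by simp), CharTwo.add_self_eq_zero, zero_mul]
      · rw [ih hs fun x hx y hy => h x (List.mem_cons_of_mem _ hx) y (List.mem_cons_of_mem _ hy),
          mul_zero]

theorem signChanges_map {ν : V → V} {X : Set V} {ss : List (V → ZMod 2)}
    (hss : ∀ s ∈ ss, ∀ x ∈ X, s (ν x) = s x + 1) {l : List V} (hl : ∀ x ∈ l, x ∈ X) :
    signChanges ss (l.map ν) = signChanges ss l := by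
  induction ss generalizing l with
  | nil => match l with
    | [] => rfl
    | [v] => rfl
    | v :: w :: l => rfl
  | cons s ss ih =>
    match l with
    | [] => rfl
    | [v] => rfl
    | v :: w :: l =>
      have h := ih (fun s hs => hss s (List.mem_cons_of_mem _ hs)) (l := w :: l)
        fun x hx => hl x (List.mem_cons_of_mem _ hx)
      simp only [List.map_cons] at h
      simp only [List.map_cons, signChanges, h, hss s (by simp) v (hl v (by simp)),
        hss s (by simp) w (hl w (by simp))]
      congr 1
      rw [add_add_add_comm, CharTwo.add_self_eq_zero, add_zero]

/-- The product `α` of coboundaries is `ν`-invariant, so a simplex with first vertex `v` contributes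
`(s v + (s v + 1)) α = α`. -/
theorem extend_headMulSignChanges_add_map {ν : V → V} {X : Set V} {s : V → ZMod 2}
    {ss : List (V → ZMod 2)} (hs : ∀ x ∈ X, s (ν x) = s x + 1)
    (hss : ∀ s ∈ ss, ∀ x ∈ X, s (ν x) = s x + 1) {c : OrderedChain V}
    (hc : c ∈ supportedOn fun l => ∀ x ∈ l, x ∈ X) :
    extend (headMulSignChanges s ss) (c + map ν c) = extend (signChanges ss) c := by
  refine eq_of_mem (f := extend (headMulSignChanges s ss) ∘ₗ (LinearMap.id + map ν))
    (fun l hl => ?_) hc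
  cases l with
  | nil => simp [headMulSignChanges, signChanges_nil_right]
  | cons v l =>
    have h := signChanges_map hss hl
    rw [List.map_cons] at h
    simp only [LinearMap.comp_apply, LinearMap.add_apply, LinearMap.id_apply, map_of, map_add,
      extend_of, List.map_cons, headMulSignChanges, h, hs v (hl v (by simp))]
    rw [← add_mul, ← add_assoc, CharTwo.add_self_eq_zero, zero_add, one_mul]

/-- If `h 0, h 1, …` are the hemispheres of an antipodal sphere, then the product of the
coboundaries of `k` odd functions is nonzero on `h k`. -/
theorem extend_signChanges_eq_one {ν : V → V} {X : Set V} {d : ℕ} {h : ℕ → OrderedChain V}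
    (hX : ∀ k ≤ d, h k ∈ supportedOn fun l => ∀ x ∈ l, x ∈ X) {v : V} (h0 : h 0 = of [v])
    (hbd : ∀ k < d, boundary (h (k + 1)) = h k + map ν (h k)) {ss : List (V → ZMod 2)}
    (hss : ∀ s ∈ ss, ∀ x ∈ X, s (ν x) = s x + 1) (hlen : ss.length ≤ d) :
    extend (signChanges ss) (h ss.length) = 1 := by
  induction ss with
  | nil => simp [h0, signChanges]
  | cons s ss ih =>
    simp only [List.length_cons] at hlen ⊢
    have hss' : ∀ s ∈ ss, ∀ x ∈ X, s (ν x) = s x + 1 :=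
      fun s hs => hss s (List.mem_cons_of_mem _ hs)
    -- Stokes moves the coboundary of `s` to the boundary of the hemisphere, and oddness folds the
    -- two halves of that boundary into one.
    rw [extend_signChanges_cons, hbd _ hlen,
      extend_headMulSignChanges_add_map (hss s (by simp)) hss' (hX _ (by omega)),
      ih hss' (by omega)]

/-! ### Barycentric subdivision -/

section Subdivision

variable {E : Type*} [NormedAddCommGroup E] [NormedSpace ℝ E]

/-- The barycentre of a list of points. -/
noncomputable def barycentre (l : List E) : E := (l.length : ℝ)⁻¹ • l.sum

/-- Barycentric subdivision of chains of simplices with `n` vertices. -/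
noncomputable def subdivision : ℕ → OrderedChain E →ₗ[ZMod 2] OrderedChain E
  | 0 => LinearMap.id
  | n + 1 => extend fun l => cone (barycentre l) (subdivision n (boundary (of l)))

theorem subdivision_succ_of (n : ℕ) (l : List E) :
    subdivision (n + 1) (of l) = cone (barycentre l) (subdivision n (boundary (of l))) := by
  simp [subdivision]

theorem barycentre_map_neg (l : List E) : barycentre (l.map Neg.neg) = -barycentre l := by
  have : (l.map Neg.neg).sum = -l.sum := by
    induction l with
    | nil => simp
    | cons v l ih => simp [ih, add_comm]
  simp [barycentre, this]

theorem subdivision_map_neg (n : ℕ) (c : OrderedChain E) :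
    subdivision n (map Neg.neg c) = map Neg.neg (subdivision n c) := by
  induction n generalizing c with
  | zero => rfl
  | succ n ih =>
    have : subdivision (n + 1) ∘ₗ map Neg.neg =
        map Neg.neg ∘ₗ (subdivision (n + 1) : OrderedChain E →ₗ[ZMod 2] _) :=
      hom_ext fun l => by
        simp only [LinearMap.comp_apply, map_of, subdivision_succ_of, map_cone,
          barycentre_map_neg, ← ih, ← boundary_map]
    exact LinearMap.congr_fun this c

/-- The cone formula leaves a term that vanishes by induction and `∂∂ = 0`. The index counts
vertices, so it drops by one under the boundary. -/
theorem boundary_subdivision (n : ℕ) {c : OrderedChain E}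
    (hc : c ∈ supportedOn fun l => l.length = n + 1) :
    boundary (subdivision (n + 1) c) = subdivision n (boundary c) := by
  induction n generalizing c with
  | zero =>
    have h (l : List E) (hl : l.length = 1) :
        boundary (subdivision 1 (of l)) = subdivision 0 (boundary (of l)) := by
      obtain ⟨v, rfl⟩ := List.length_eq_one_iff.1 hl
      simp [subdivision, boundary_of_cons]
    have h' := eq_of_mem (f := boundary ∘ₗ subdivision 1) (g := subdivision 0 ∘ₗ boundary)
      (fun l hl => by simpa only [LinearMap.comp_apply] using h l hl) hc
    simpa only [LinearMap.comp_apply] using h'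
  | succ n ih =>
    have h (l : List E) (hl : l.length = n + 1 + 1) :
        boundary (subdivision (n + 1 + 1) (of l)) = subdivision (n + 1) (boundary (of l)) := by
      have : boundary (of l) ∈ supportedOn fun l' => l'.length = n + 1 :=
        supportedOn_mono (fun l' hl' => by have := hl'.1; omega) (boundary_of_mem l)
      rw [subdivision_succ_of, boundary_cone, ih this, boundary_boundary]
      simp
    have h' := eq_of_mem (f := boundary ∘ₗ subdivision (n + 1 + 1))
      (g := subdivision (n + 1) ∘ₗ boundary)
      (fun l hl => by simpa only [LinearMap.comp_apply] using h l hl) hc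
    simpa only [LinearMap.comp_apply] using h'

/-- With `n + 1` vertices, `x` minus the barycentre is `(n + 1)⁻¹` times a sum of `n` differences `x
- y`, and `n / (n + 1)` increases with `n`. -/
theorem dist_barycentre_le {d : ℕ} {D : ℝ} {l : List E} (hd : l.length ≤ d + 1)
    (hD : ∀ x ∈ l, ∀ y ∈ l, dist x y ≤ D) {x : E} (hx : x ∈ l) :
    dist x (barycentre l) ≤ d / (d + 1) * D := by
  classical
  have hD0 : 0 ≤ D := dist_nonneg.trans (hD x hx x hx)
  obtain ⟨n, hn⟩ : ∃ n, l.length = n + 1 :=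
    Nat.exists_eq_succ_of_ne_zero (List.length_pos_of_mem hx).ne'
  have hperm := List.perm_cons_erase hx
  have hlen : (l.erase x).length = n := by rw [List.length_erase_of_mem hx, hn]; rfl
  have hsum : l.sum = x + (l.erase x).sum := by rw [hperm.sum_eq, List.sum_cons]
  have key : ∀ m : List E, (∀ y ∈ m, dist x y ≤ D) →
      ‖(m.length : ℝ) • x - m.sum‖ ≤ m.length * D := by
    intro m hm
    induction m with
    | nil => simp
    | cons y m ih =>
      have h1 := ih fun z hz => hm z (List.mem_cons_of_mem _ hz)
      have h2 := hm y (by simp)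
      rw [dist_eq_norm] at h2
      have : ((y :: m).length : ℝ) • x - (y :: m).sum =
          (x - y) + ((m.length : ℝ) • x - m.sum) := by
        simp only [List.length_cons, List.sum_cons, Nat.cast_succ, add_smul, one_smul]
        abel
      rw [this]
      refine (norm_add_le _ _).trans ?_
      simp only [List.length_cons, Nat.cast_succ]
      linarith
  have h1 := key (l.erase x) fun y hy => hD x hx y (List.mem_of_mem_erase hy)
  rw [hlen] at h1
  have hn0 : (0 : ℝ) < n + 1 := by positivity
  have h2 : x - barycentre l = ((n : ℝ) + 1)⁻¹ • ((n : ℝ) • x - (l.erase x).sum) := by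
    rw [barycentre, hsum, hn, eq_inv_smul_iff₀ hn0.ne', smul_sub, Nat.cast_succ,
      smul_inv_smul₀ hn0.ne', add_smul, one_smul]
    abel
  rw [dist_eq_norm, h2, norm_smul, Real.norm_of_nonneg (by positivity)]
  have hnd : (n : ℝ) ≤ d := by exact_mod_cast (by omega : n ≤ d)
  have h3 : (n : ℝ) / (n + 1) ≤ d / (d + 1) := by
    rw [div_le_div_iff₀ (by positivity) (by positivity)]
    nlinarith
  calc ((n : ℝ) + 1)⁻¹ * ‖(n : ℝ) • x - (l.erase x).sum‖ ≤ ((n : ℝ) + 1)⁻¹ * (n * D) := by gcongr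
    _ = n / (n + 1) * D := by field_simp
    _ ≤ _ := by gcongr

theorem barycentre_mem_convexHull {l : List E} (hl : l ≠ []) :
    barycentre l ∈ convexHull ℝ {x | x ∈ l} := by
  have hpos : 0 < l.length := List.length_pos_of_ne_nil hl
  have hs : ∑ i : Fin l.length, l[i] = l.sum := Fin.sum_univ_getElem l
  rw [barycentre, ← hs, Finset.smul_sum]
  refine (convex_convexHull ℝ _).sum_mem (fun _ _ => by positivity) ?_ fun i _ =>
    subset_convexHull ℝ _ (List.getElem_mem i.2)
  simp [hpos.ne']

theorem subdivision_of_mem {d n : ℕ} {D : ℝ} {l : List E} (hn : l.length = n) (hd : n ≤ d + 1)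
    (hD : ∀ x ∈ l, ∀ y ∈ l, dist x y ≤ D) :
    subdivision n (of l) ∈ supportedOn fun l' => l'.length = n ∧
      (∀ x ∈ l', x ∈ convexHull ℝ {x | x ∈ l}) ∧
      ∀ x ∈ l', ∀ y ∈ l', dist x y ≤ d / (d + 1) * D := by
  induction n generalizing l with
  | zero =>
    obtain rfl := List.length_eq_zero_iff.1 hn
    exact of_mem (by simp)
  | succ n ih =>
    have hl : l ≠ [] := by rintro rfl; simp at hn
    rw [subdivision_succ_of]
    refine map_mem (Q := fun l' => l'.length = n ∧
      (∀ x ∈ l', x ∈ convexHull ℝ {x | x ∈ l}) ∧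
      ∀ x ∈ l', ∀ y ∈ l', dist x y ≤ d / (d + 1) * D) ?_ ?_
    · rintro l' ⟨h1, h2, h3⟩
      -- Balls are convex, so the bound at the vertices of `l` extends to all new vertices.
      have hball : convexHull ℝ {x | x ∈ l} ⊆
          Metric.closedBall (barycentre l) (d / (d + 1) * D) :=
        convexHull_min (fun x hx => dist_barycentre_le (by omega) hD hx) (convex_closedBall _ _)
      have hb : ∀ x ∈ l', dist x (barycentre l) ≤ d / (d + 1) * D :=
        fun x hx => hball (h2 x hx)
      obtain ⟨y, hy⟩ := List.exists_mem_of_ne_nil l hl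
      have hD0 : 0 ≤ D := dist_nonneg.trans (hD y hy y hy)
      rw [cone_of]
      refine of_mem ⟨by simp [h1], ?_, ?_⟩
      · rintro x hx
        rcases List.mem_cons.1 hx with rfl | hx
        · exact barycentre_mem_convexHull hl
        · exact h2 x hx
      · intro x hx y hy
        rcases List.mem_cons.1 hx with rfl | hx <;> rcases List.mem_cons.1 hy with rfl | hy
        · rw [dist_self]; positivity
        · rw [dist_comm]; exact hb y hy
        · exact hb x hx
        · exact h3 x hx y hy
    · refine map_mem (fun l' hl' => ?_) (boundary_of_mem l)
      refine supportedOn_mono ?_ (ih (l := l') (by have := hl'.1; omega) (by omega)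
        fun x hx y hy => hD x (hl'.2 hx) y (hl'.2 hy))
      rintro m ⟨h1, h2, h3⟩
      exact ⟨h1, fun x hx => convexHull_mono (fun _ h => hl'.2 h) (h2 x hx), h3⟩

end Subdivision

/-! ### Subdivided hemispheres of the octahedral sphere -/

section Hemisphere

variable {E : Type*} [NormedAddCommGroup E]

/-- The hemispheres of the octahedral spheres spanned by the vectors `±e 0, ±e 1, …`. -/
noncomputable def hemisphere (e : ℕ → E) : ℕ → OrderedChain E
  | 0 => of [e 0]
  | k + 1 => cone (e (k + 1)) (hemisphere e k + map Neg.neg (hemisphere e k))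

/-- Coning a cycle bounds it. The sum of the two hemispheres is a cycle because both have the same
antipodally symmetric boundary, which cancels modulo two. -/
theorem boundary_hemisphere (e : ℕ → E) (k : ℕ) :
    boundary (hemisphere e (k + 1)) = hemisphere e k + map Neg.neg (hemisphere e k) := by
  suffices h : boundary (hemisphere e k + map Neg.neg (hemisphere e k)) = 0 by
    rw [hemisphere, boundary_cone, h, map_zero, add_zero]
  induction k with
  | zero => simp [hemisphere, boundary_of_cons, add_self]
  | succ k ih =>
    rw [map_add, boundary_map, hemisphere, boundary_cone, ih, map_zero, add_zero, map_add,
      map_neg_map_neg, add_comm (map _ _), add_self]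

variable [InnerProductSpace ℝ E]

/-- The iterated barycentric subdivision of `hemisphere`. -/
noncomputable def fineHemisphere (e : ℕ → E) : ℕ → ℕ → OrderedChain E
  | 0, k => hemisphere e k
  | N + 1, k => subdivision (k + 1) (fineHemisphere e N k)

/-- All vertices of `l` lie on the far side of a hyperplane at distance at least `(k + 1)⁻¹`
from the origin. -/
def FarFromOrigin (k : ℕ) (l : List E) : Prop :=
  ∃ u : E, ‖u‖ ≤ k + 1 ∧ ∀ x ∈ l, 1 ≤ inner ℝ u x

theorem hemisphere_mem_aux {e : ℕ → E} {d : ℕ}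
    (he : ∀ i ≤ d, ∀ j ≤ d, inner ℝ (e i) (e j) = if i = j then (1 : ℝ) else 0)
    {k : ℕ} (hk : k ≤ d) : hemisphere e k ∈ supportedOn fun l => l.length = k + 1 ∧
      (∀ x ∈ l, ‖x‖ ≤ 1) ∧ (∀ j ≤ d, k < j → ∀ x ∈ l, inner ℝ (e j) x = (0 : ℝ)) ∧
      ∃ u : E, ‖u‖ ≤ k + 1 ∧ (∀ j ≤ d, k < j → inner ℝ u (e j) = (0 : ℝ)) ∧
        ∀ x ∈ l, 1 ≤ inner ℝ u x := by
  have hnorm : ∀ i ≤ d, ‖e i‖ = 1 := fun i hi => by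
    rw [norm_eq_sqrt_real_inner, he i hi i hi]; simp
  induction k with
  | zero =>
    refine of_mem ⟨rfl, by simp [hnorm 0 hk], fun j hj hj' => ?_, e 0, by simp [hnorm 0 hk],
      fun j hj hj' => ?_, ?_⟩
    · simp [he j hj 0 hk, hj'.ne']
    · simp [he 0 hk j hj, hj'.ne]
    · simp [hnorm 0 hk]
  | succ k ih =>
    have ih := ih (by omega)
    refine map_mem ?_ (add_mem ih (map_mem ?_ ih))
    · rintro l ⟨h1, h2, h3, u, hu1, hu2, hu3⟩
      rw [cone_of]
      -- The witness is the sum of the vertices; orthogonality to the later `e j` keeps its inner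
      -- product with each vertex equal to that of the earlier step.
      refine of_mem ⟨by simp [h1], ?_, ?_, u + e (k + 1), ?_, ?_, ?_⟩
      · rintro x hx
        rcases List.mem_cons.1 hx with rfl | hx
        · exact (hnorm _ hk).le
        · exact h2 x hx
      · intro j hj hj' x hx
        rcases List.mem_cons.1 hx with rfl | hx
        · rw [he j hj _ hk, if_neg hj'.ne']
        · exact h3 j hj (by omega) x hx
      · refine (norm_add_le _ _).trans ?_
        rw [hnorm _ hk]
        push_cast
        linarith
      · intro j hj hj'
        rw [inner_add_left, hu2 j hj (by omega), he _ hk j hj, if_neg hj'.ne, add_zero]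
      · intro x hx
        rw [inner_add_left]
        rcases List.mem_cons.1 hx with rfl | hx
        · rw [hu2 _ hk (by omega), he _ hk _ hk, if_pos rfl, zero_add]
        · rw [h3 _ hk (by omega) x hx, add_zero]
          exact hu3 x hx
    · rintro l ⟨h1, h2, h3, u, hu1, hu2, hu3⟩
      rw [map_of]
      refine of_mem ⟨by simp [h1], ?_, ?_, -u, by simpa using hu1, ?_, ?_⟩
      · simpa only [List.forall_mem_map, norm_neg] using h2
      · simpa only [List.forall_mem_map, inner_neg_right, neg_eq_zero] using h3
      · simpa only [inner_neg_left, neg_eq_zero] using hu2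
      · simpa only [List.forall_mem_map, inner_neg_neg] using hu3

/-- Subdivision stays inside convex hulls, hence inside the separating half-spaces, so the distance
from the origin is bounded below independently of `N`. -/
theorem fineHemisphere_mem {e : ℕ → E} {d : ℕ}
    (he : ∀ i ≤ d, ∀ j ≤ d, inner ℝ (e i) (e j) = if i = j then (1 : ℝ) else 0)
    (N : ℕ) {k : ℕ} (hk : k ≤ d) : fineHemisphere e N k ∈ supportedOn fun l =>
      l.length = k + 1 ∧ FarFromOrigin k l ∧
      ∀ x ∈ l, ∀ y ∈ l, dist x y ≤ (d / (d + 1) : ℝ) ^ N * 2 := by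
  induction N with
  | zero =>
    refine supportedOn_mono ?_ (hemisphere_mem_aux he hk)
    rintro l ⟨h1, h2, -, u, hu1, -, hu3⟩
    refine ⟨h1, ⟨u, hu1, hu3⟩, fun x hx y hy => ?_⟩
    have := dist_le_norm_add_norm x y
    linarith [h2 x hx, h2 y hy]
  | succ N ih =>
    refine map_mem ?_ ih
    rintro l ⟨h1, ⟨u, hu1, hu2⟩, h3⟩
    refine supportedOn_mono ?_ (subdivision_of_mem (d := d) h1 (by omega) h3)
    rintro l' ⟨h1', h2', h3'⟩
    refine ⟨h1', ⟨u, hu1, fun x hx => ?_⟩, fun x hx y hy => (h3' x hx y hy).trans_eq (by ring)⟩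
    have hconv : Convex ℝ {x : E | 1 ≤ inner ℝ u x} :=
      convex_halfSpace_ge (innerSL ℝ u).toLinearMap.isLinear 1
    exact convexHull_min hu2 hconv (h2' x hx)

theorem fineHemisphere_zero (e : ℕ → E) (N : ℕ) : fineHemisphere e N 0 = of [e 0] := by
  induction N with
  | zero => rfl
  | succ N ih =>
    rw [fineHemisphere, ih]
    simp [subdivision, boundary_of_cons, barycentre]

theorem boundary_fineHemisphere {e : ℕ → E} {d : ℕ}
    (he : ∀ i ≤ d, ∀ j ≤ d, inner ℝ (e i) (e j) = if i = j then (1 : ℝ) else 0)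
    (N : ℕ) {k : ℕ} (hk : k < d) : boundary (fineHemisphere e N (k + 1)) =
      fineHemisphere e N k + map Neg.neg (fineHemisphere e N k) := by
  induction N with
  | zero => exact boundary_hemisphere e k
  | succ N ih =>
    have := supportedOn_mono (fun l hl => hl.1) (fineHemisphere_mem he N (k := k + 1) hk)
    rw [fineHemisphere, boundary_subdivision _ this, ih, map_add, subdivision_map_neg,
      fineHemisphere]

end Hemisphere

end OrderedChain

/-! ### Radial projection and odd functions on the round sphere -/

theorem norm_inv_smul_sub_le {E : Type*} [NormedAddCommGroup E] [NormedSpace ℝ E] {x y : E}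
    (hx : x ≠ 0) (hy : y ≠ 0) :
    ‖‖x‖⁻¹ • x - ‖y‖⁻¹ • y‖ ≤ ‖x‖⁻¹ * (2 * ‖x - y‖) := by
  have hx' := norm_pos_iff.2 hx
  have hy' := norm_pos_iff.2 hy
  have h : ‖x‖⁻¹ • x - ‖y‖⁻¹ • y =
      ‖x‖⁻¹ • ((x - y) + ((‖y‖ - ‖x‖) * ‖y‖⁻¹) • y) := by
    rw [smul_add, smul_sub, smul_smul]
    have : ‖x‖⁻¹ * ((‖y‖ - ‖x‖) * ‖y‖⁻¹) = ‖x‖⁻¹ - ‖y‖⁻¹ := by field_simp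
    rw [this, sub_smul]
    abel
  rw [h, norm_smul, norm_inv, norm_norm]
  gcongr
  refine (norm_add_le _ _).trans ?_
  rw [norm_smul, norm_mul, norm_inv, norm_norm, inv_mul_cancel_right₀ hy'.ne', Real.norm_eq_abs]
  have := abs_norm_sub_norm_le y x
  rw [norm_sub_rev] at this
  linarith

/-- Among finitely many odd two-valued functions on the sphere, fewer than its ambient dimension,
there are arbitrarily close points on which none of them is constant. -/
theorem exists_small_list_of_odd {d : ℕ}
    {χ : Fin d → Metric.sphere (0 : EuclideanSpace ℝ (Fin (d + 1))) 1 → ZMod 2}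
    (hχ : ∀ i x, χ i (-x) = χ i x + 1) {δ : ℝ} (hδ : 0 < δ) :
    ∃ l : List (Metric.sphere (0 : EuclideanSpace ℝ (Fin (d + 1))) 1), l ≠ [] ∧
      (∀ x ∈ l, ∀ y ∈ l, dist x y < δ) ∧ ∀ i, ∃ x ∈ l, ∃ y ∈ l, χ i x ≠ χ i y := by
  classical
  let e : ℕ → EuclideanSpace ℝ (Fin (d + 1)) :=
    fun k => EuclideanSpace.single (Fin.ofNat (d + 1) k) 1
  have he : ∀ i ≤ d, ∀ j ≤ d, inner ℝ (e i) (e j) = if i = j then (1 : ℝ) else 0 := by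
    intro i hi j hj
    have : Fin.ofNat (d + 1) i = Fin.ofNat (d + 1) j ↔ i = j := by
      simp [Fin.ext_iff, Fin.ofNat, Nat.mod_eq_of_lt (Nat.lt_succ_of_le hi),
        Nat.mod_eq_of_lt (Nat.lt_succ_of_le hj)]
    simp only [e, EuclideanSpace.inner_single_left, PiLp.single_apply, this]
    simp
  -- Radial projection; the value at 0 is arbitrary, as no simplex has 0 as a vertex.
  let ρ : EuclideanSpace ℝ (Fin (d + 1)) →
      Metric.sphere (0 : EuclideanSpace ℝ (Fin (d + 1))) 1 := fun v =>
    if h : v = 0 then ⟨e 0, mem_sphere_zero_iff_norm.2 (by simp [e])⟩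
    else ⟨‖v‖⁻¹ • v, mem_sphere_zero_iff_norm.2 (by simp [norm_smul, h])⟩
  have hρ : ∀ v : EuclideanSpace ℝ (Fin (d + 1)), v ≠ 0 → (ρ v).val = ‖v‖⁻¹ • v :=
    fun v hv => by simp [ρ, hv]
  have hρneg : ∀ v : EuclideanSpace ℝ (Fin (d + 1)), v ≠ 0 → ρ (-v) = -ρ v := fun v hv => by
    ext1
    simp [hρ v hv, hρ (-v) (neg_ne_zero.2 hv)]
  by_contra! hcon
  -- The 4 is the initial diameter bound 2 times the 2 from `norm_inv_smul_sub_le`; `d + 1` bounds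
  -- `‖x‖⁻¹`.
  obtain ⟨N, hN⟩ : ∃ N : ℕ, (d / (d + 1) : ℝ) ^ N < δ / (4 * (d + 1)) :=
    exists_pow_lt_of_lt_one (by positivity)
      (by rw [div_lt_one (by positivity)]; linarith)
  let ss : List (EuclideanSpace ℝ (Fin (d + 1)) → ZMod 2) := List.ofFn fun i => χ i ∘ ρ
  have hlen : ss.length = d := List.length_ofFn
  have hfar : ∀ k, ∀ l : List (EuclideanSpace ℝ (Fin (d + 1))), OrderedChain.FarFromOrigin k l →
      ∀ x ∈ l, x ≠ 0 ∧ ‖x‖⁻¹ ≤ k + 1 := by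
    rintro k l ⟨u, hu1, hu2⟩ x hx
    have h1 := (hu2 x hx).trans (real_inner_le_norm u x)
    have hx0 : 0 < ‖x‖ := by
      by_contra! h
      nlinarith [norm_nonneg u, norm_nonneg x]
    refine ⟨norm_pos_iff.1 hx0, ?_⟩
    rw [inv_le_iff_one_le_mul₀ hx0]
    nlinarith
  have hone := OrderedChain.extend_signChanges_eq_one (ν := Neg.neg)
    (X := {v : EuclideanSpace ℝ (Fin (d + 1)) | v ≠ 0})
    (d := d) (h := OrderedChain.fineHemisphere e N) (ss := ss)
    (fun k hk => OrderedChain.supportedOn_mono (fun l hl x hx => (hfar k l hl.2.1 x hx).1)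
      (OrderedChain.fineHemisphere_mem he N hk))
    (OrderedChain.fineHemisphere_zero e N)
    (fun k hk => OrderedChain.boundary_fineHemisphere he N hk)
    (by
      intro s hs x hx
      obtain ⟨i, rfl⟩ := List.mem_ofFn.1 hs
      simp [hρneg x hx, hχ])
    hlen.le
  have hzero : OrderedChain.extend (OrderedChain.signChanges ss)
      (OrderedChain.fineHemisphere e N ss.length) = 0 := by
    rw [hlen]
    refine OrderedChain.eq_of_mem (g := 0) ?_ (OrderedChain.fineHemisphere_mem he N le_rfl)
    rintro l ⟨h1, h2, h3⟩
    rw [OrderedChain.extend_of, LinearMap.zero_apply]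
    obtain ⟨i, hi⟩ := hcon (l.map ρ) (by rintro h; simp at h; simp [h] at h1) (by
      intro x' hx' y' hy'
      obtain ⟨x, hx, rfl⟩ := List.mem_map.1 hx'
      obtain ⟨y, hy, rfl⟩ := List.mem_map.1 hy'
      obtain ⟨hx0, hx1⟩ := hfar d l h2 x hx
      have hy0 := (hfar d l h2 y hy).1
      rw [Subtype.dist_eq, hρ x hx0, hρ y hy0, dist_eq_norm]
      have h4 := h3 x hx y hy
      rw [dist_eq_norm] at h4
      rw [lt_div_iff₀ (by positivity)] at hN
      calc _ ≤ ‖x‖⁻¹ * (2 * ‖x - y‖) := norm_inv_smul_sub_le hx0 hy0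
        _ ≤ (d + 1) * (2 * ((d / (d + 1) : ℝ) ^ N * 2)) := by gcongr
        _ < δ := by linarith)
    exact OrderedChain.signChanges_eq_zero (List.mem_ofFn.2 ⟨i, rfl⟩) fun x hx y hy =>
      hi _ (List.mem_map_of_mem hx) _ (List.mem_map_of_mem hy)
  exact zero_ne_one (hzero.symm.trans hone)

/-! ### Components of symmetric sets and the covering argument -/

theorem connectedComponentIn_neg {X : Type*} [TopologicalSpace X] [InvolutiveNeg X]
    [ContinuousNeg X] {C : Set X} (hC : -C = C) {x : X} (hx : x ∈ C) :
    connectedComponentIn C (-x) = -connectedComponentIn C x := by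
  have h := (Homeomorph.neg X).image_connectedComponentIn hx
  simp only [Homeomorph.coe_neg, Set.image_neg_eq_neg, hC] at h
  exact h.symm

/-- A set-valued equivariant function whose values are never symmetric yields an odd function. -/
theorem exists_odd_of_equivariant {X : Type*} [InvolutiveNeg X] {K : X → Set X}
    (hK : ∀ x, K (-x) = -K x) (hK' : ∀ x, K x ≠ -K x) :
    ∃ χ : X → ZMod 2, (∀ x, χ (-x) = χ x + 1) ∧ ∀ x y, K x = K y → χ x = χ y := by
  classical
  -- A well-ordering of all subsets picks one from each pair `K x`, `-K x`.
  refine ⟨fun x => if WellOrderingRel (K x) (-K x) then 1 else 0, fun x => ?_, fun x y h => ?_⟩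
  · simp only [hK, neg_neg]
    rcases trichotomous_of WellOrderingRel (K x) (-K x) with h | h | h
    · rw [if_pos h, if_neg (asymm_of WellOrderingRel h)]; rfl
    · exact absurd h (hK' x)
    · rw [if_pos h, if_neg (asymm_of WellOrderingRel h)]; rfl
  · simp only [h]

theorem theorem10 (d : ℕ)
    (C : Fin d → Set (Metric.sphere (0 : EuclideanSpace ℝ (Fin (d + 1))) 1))
    (hopen : ∀ i, IsOpen (C i))
    (hsymm : ∀ i, -C i = C i)
    (hcover : ⋃ i, C i = Set.univ) :
    ∃ i, ∃ x ∈ C i, -x ∈ connectedComponentIn (C i) x := by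
  classical
  by_contra! hcon
  have : Fact (Module.finrank ℝ (EuclideanSpace ℝ (Fin (d + 1))) = d + 1) := ⟨by simp⟩
  have : LocallyConnectedSpace (Metric.sphere (0 : EuclideanSpace ℝ (Fin (d + 1))) 1) :=
    ChartedSpace.locallyConnectedSpace (EuclideanSpace ℝ (Fin d)) _
  have hχ (i : Fin d) : ∃ χ : Metric.sphere (0 : EuclideanSpace ℝ (Fin (d + 1))) 1 → ZMod 2,
      (∀ x, χ (-x) = χ x + 1) ∧ ∀ x ∈ C i, ∀ y ∈ C i,
        connectedComponentIn (C i) x = connectedComponentIn (C i) y → χ x = χ y := by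
    have hmem (x) : -x ∈ C i ↔ x ∈ C i := by rw [← Set.mem_neg, hsymm]
    obtain ⟨χ, h1, h2⟩ := exists_odd_of_equivariant
      -- Singletons off `C i` keep the map equivariant and never symmetric, since `x ≠ -x` on the
      -- sphere.
      (K := fun x => if x ∈ C i then connectedComponentIn (C i) x else {x})
      (fun x => by
        by_cases hx : x ∈ C i
        · simp [hmem, hx, connectedComponentIn_neg (hsymm i) hx]
        · simp [hmem, hx])
      (fun x h => by
        by_cases hx : x ∈ C i
        · simp only [hx, if_true] at h
          refine hcon i x hx ?_
          rw [h, Set.neg_mem_neg]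
          exact mem_connectedComponentIn hx
        · simp only [hx, if_false, Set.neg_singleton, Set.singleton_eq_singleton_iff] at h
          exact ne_neg_of_mem_unit_sphere ℝ x h)
    exact ⟨χ, h1, fun x hx y hy h => h2 x y (by simpa [hx, hy] using h)⟩
  choose χ hodd hconst using hχ
  -- The cover consists of the components, open by local connectedness, rather than of the sets `C
  -- i`.
  obtain ⟨δ, hδ, hball⟩ := lebesgue_number_lemma_of_metric
    (s := (Set.univ : Set (Metric.sphere (0 : EuclideanSpace ℝ (Fin (d + 1))) 1)))
    (c := fun p : Fin d × Metric.sphere (0 : EuclideanSpace ℝ (Fin (d + 1))) 1 =>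
      connectedComponentIn (C p.1) p.2) isCompact_univ
    (fun p => (hopen p.1).connectedComponentIn) (fun x _ => by
      obtain ⟨i, hi⟩ := Set.mem_iUnion.1 (hcover.symm ▸ Set.mem_univ x : x ∈ ⋃ i, C i)
      exact Set.mem_iUnion.2 ⟨(i, x), mem_connectedComponentIn hi⟩)
  obtain ⟨l, hl, hsmall, hne⟩ := exists_small_list_of_odd hodd hδ
  obtain ⟨z, hz⟩ := List.exists_mem_of_ne_nil l hl
  obtain ⟨⟨i, p⟩, hp⟩ := hball z trivial
  obtain ⟨x, hx, y, hy, hxy⟩ := hne i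
  have hmem : ∀ w ∈ l, w ∈ connectedComponentIn (C i) p := fun w hw => hp (hsmall w hw z hz)
  have hsub := connectedComponentIn_subset (C i) p
  exact hxy (hconst i x (hsub (hmem x hx)) y (hsub (hmem y hy))
    ((connectedComponentIn_eq (hmem x hx)).symm.trans (connectedComponentIn_eq (hmem y hy))))
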